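/- A (real) left-symmetric algebra (LSA) is a real vector space $A$ with a bilinear product whose associator $(xy)z-x(yz)$ is symmetric in $x,y$. Write $L(a)b=ab$, $R(a)b=ba$ for the left and right multiplications, $P(x)=\det(I+R(x))$ for the characteristic polynomial, and $\tau(x,y)=\operatorname{tr}R(x)R(y)$ for the trace-form of a finite-dimensional LSA. A right principal idempotent is an idempotent $r$ with $\operatorname{tr}R(x)=\tau(r,x)$ for all $x$; there is at most one if $\tau$ is nondegenerate. Fix a nonzero parallel volume form $\Psi$ on $A$, and for smooth $F$ on $A$ let $\mathcal H(F)=\det\big(\partial^2F/\partial x^i\partial x^j\big)$ in linear coordinates $x^1,\dots,x^n$ with $\Psi=dx^1\wedge\dots\wedge dx^n$. **Theorem.** Let $A$ be an $n$-dimensional LSA with characteristic polynomial $P$. Suppose there are $0\neq v\in A$ and $\alpha\in\mathbb R$ with $P(x+tv)=P(x)+\alpha t$ for all $x\in A$, $t\in\mathbb R$, and that $2\operatorname{tr}L(x)=(n+1)\operatorname{tr}R(x)$ for all $x\in A$. Then there is a constant $\kappa\in\mathbb R$ with $\mathcal H(e^P)=\kappa e^{nP}$ on $A$. If, moreover, $\tau$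 is nondegenerate, then: 1. $\kappa\neq0$, and for every $s\in\mathbb R$ the level set $\{P=s\}$ is a (connected) improper affine sphere, whose equiaffine normal is a constant nonzero multiple of $v$; 2. $\alpha\neq0$, the element $r=\alpha^{-1}v$ is the right principal idempotent of $A$, and $\operatorname{tr}R(r)=1$. Here an equiaffine normal of a smooth hypersurface $M$ is a smooth transverse field $\xi$ such that, writing $D_XY=\nabla_XY+h(X,Y)\xi$ and $D_X\xi=-S(X)+\theta(X)\xi$ for the flat connection $D$, tangent $X,Y$, and tangent $\nabla_XY$, $S(X)$, the form $h$ is nondegenerate, $\theta=0$, and $\Psi(\xi,X_1,\dots,X_{n-1})^2=|\det h(X_i,X_j)|$ for all tangent $X_1,\dots,X_{n-1}$ (it is unique up to sign on connected $M$). A connected $M$ is an improper affine sphere if it has an equiaffine normal whose shape operator $S$ vanishes. -/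

import Mathlib

open scoped ContDiff Topology

noncomputable section

/-! ### Left-symmetric algebras

A left-symmetric algebra (LSA) is a left pre-Lie algebra: its associator is symmetric in the first
two arguments.  Equivalently `[a, b] = a * b - b * a` is a Lie bracket and left multiplication is a
representation of it. -/

section LSA

variable (A : Type*) [LeftPreLieRing A] [LeftPreLieAlgebra ℝ A]

/-- The left regular map `L`, with `L a b = a * b`. -/
def lsaLeft : A →ₗ[ℝ] Module.End ℝ A := LinearMap.mul ℝ A

/-- The right regular map `R`, with `R a b = b * a`. -/
def lsaRight : A →ₗ[ℝ] Module.End ℝ A := (LinearMap.mul ℝ A).flip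

/-- The characteristic polynomial `P x = det (I + R x)`. -/
def lsaCharPoly (x : A) : ℝ := LinearMap.det (1 + lsaRight A x)

/-- The linear form `tr R`. -/
def lsaTraceRight : A →ₗ[ℝ] ℝ := LinearMap.trace ℝ A ∘ₗ lsaRight A

/-- The linear form `tr L`. -/
def lsaTraceLeft : A →ₗ[ℝ] ℝ := LinearMap.trace ℝ A ∘ₗ lsaLeft A

/-- The trace-form `τ (x, y) = tr (R x ∘ R y)`. -/
def lsaTraceForm : LinearMap.BilinForm ℝ A :=
  ((LinearMap.mul ℝ (Module.End ℝ A)).compl₁₂ (lsaRight A) (lsaRight A)).compr₂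
    (LinearMap.trace ℝ A)

/-- `r` is the right principal idempotent: it is idempotent and `tr R x = τ (r, x)` for all `x`
(when `τ` is nondegenerate there is at most one such `r`). -/
def IsRightPrincipalIdempotent (r : A) : Prop :=
  r * r = r ∧ ∀ x : A, lsaTraceRight A x = lsaTraceForm A r x

end LSA

/-- The Hessian determinant `det (∂²F / ∂xⁱ ∂xʲ)` in the coordinates of `ℝⁿ`. -/
def hessianDet {n : ℕ} (F : (Fin n → ℝ) → ℝ) (x : Fin n → ℝ) : ℝ :=
  Matrix.det (Matrix.of fun i j : Fin n =>
    fderiv ℝ (fderiv ℝ F) x (Pi.single i 1) (Pi.single j 1))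

/-! ### Equiaffine geometry of hypersurfaces -/

section Hypersurface

variable {E : Type*} [NormedAddCommGroup E] [NormedSpace ℝ E]

/-- `M` is a smooth (embedded) hypersurface: near each of its points it is the zero set of a smooth
function whose differential there is nonzero. -/
def IsSmoothHypersurface (M : Set E) : Prop :=
  ∀ p ∈ M, ∃ (U : Set E) (F : E → ℝ), IsOpen U ∧ p ∈ U ∧ ContDiffOn ℝ ∞ F U ∧
    fderiv ℝ F p ≠ 0 ∧ M ∩ U = {x ∈ U | F x = 0}

/-- The vectors tangent to `M` at `p`: velocities at time `0` of smooth curves in `M`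
through `p`. -/
def tangentVectors (M : Set E) (p : E) : Set E :=
  {X | ∃ γ : ℝ → E, ContDiffAt ℝ ∞ γ 0 ∧ γ 0 = p ∧ (∀ᶠ t in 𝓝 (0 : ℝ), γ t ∈ M) ∧
    deriv γ 0 = X}

/-- `ξ` is a smooth vector field on a neighborhood of `M` that is transverse to `M`. -/
def IsTransversal (M : Set E) (ξ : E → E) : Prop :=
  (∃ U : Set E, IsOpen U ∧ M ⊆ U ∧ ContDiffOn ℝ ∞ ξ U) ∧ ∀ p ∈ M, ξ p ∉ tangentVectors M p

/-- `h`, `S` and `τ` are the second fundamental form, the shape operator and the connection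
one-form of `M` determined by the transversal `ξ` and the flat connection `D` of the ambient space:
along `M`, for tangent `X` and tangent vector fields `Y`,
`D_X Y = ∇_X Y + h (X, Y) ξ` and `D_X ξ = - S X + τ (X) ξ`, with `∇_X Y` and `S X` tangent.
Only the values of `h p`, `S p`, `τ p` on vectors tangent at `p ∈ M` matter. -/
structure IsInducedBy (M : Set E) (ξ : E → E) (h : E → E → E → ℝ) (S : E → E → E)
    (τ : E → E → ℝ) : Prop where
  gauss : ∀ p ∈ M, ∀ X ∈ tangentVectors M p, ∀ Y : E → E, ContDiffAt ℝ ∞ Y p →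
    (∀ᶠ q in 𝓝[M] p, Y q ∈ tangentVectors M q) →
    fderiv ℝ Y p X - h p X (Y p) • ξ p ∈ tangentVectors M p
  shape_tangent : ∀ p ∈ M, ∀ X ∈ tangentVectors M p, S p X ∈ tangentVectors M p
  weingarten : ∀ p ∈ M, ∀ X ∈ tangentVectors M p, fderiv ℝ ξ p X = - S p X + τ p X • ξ p

/-- The second fundamental form `h` is nondegenerate on each tangent space of `M`. -/
def IsNondegenerateOn (M : Set E) (h : E → E → E → ℝ) : Prop :=
  ∀ p ∈ M, ∀ X ∈ tangentVectors M p, (∀ Y ∈ tangentVectors M p, h p X Y = 0) → X = 0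

/-- The volume form induced on `M` by the ambient volume form `Ψ` and the transversal `ξ` is, up to
sign, the volume form of `h`.  That is, `Ψ (ξ, X₁, …, Xₘ) ^ 2 = |det h (X_i, X_j)|` for all tangent
`X₁, …, Xₘ`; the slot of `Ψ` that holds `ξ` is `i₀`, and the others hold the tangent vectors. -/
def IsVolumeNormalized {n : ℕ} (Ψ : E [⋀^Fin n]→ₗ[ℝ] ℝ) (M : Set E) (ξ : E → E)
    (h : E → E → E → ℝ) : Prop :=
  ∀ p ∈ M, ∀ (i₀ : Fin n) (X : Fin n → E), X i₀ = ξ p →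
    (∀ i, i ≠ i₀ → X i ∈ tangentVectors M p) →
    Ψ X ^ 2 = |Matrix.det (Matrix.of fun i j : {i : Fin n // i ≠ i₀} => h p (X i) (X j))|

/-- `ξ` is an equiaffine normal field of the nondegenerate hypersurface `M` with respect to the
parallel volume form `Ψ`, with equiaffine metric `h` and affine shape operator `S`: the connection
one-form of `ξ` vanishes and the volume forms induced by `ξ` and by `h` agree up to sign. -/
structure IsEquiaffineNormalWith {n : ℕ} (Ψ : E [⋀^Fin n]→ₗ[ℝ] ℝ) (M : Set E) (ξ : E → E)
    (h : E → E → E → ℝ) (S : E → E → E) : Prop where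
  transversal : IsTransversal M ξ
  induced : IsInducedBy M ξ h S (fun _ _ => 0)
  nondegenerate : IsNondegenerateOn M h
  volume : IsVolumeNormalized Ψ M ξ h

/-- `ξ` is an equiaffine normal field of `M`. -/
def IsEquiaffineNormal {n : ℕ} (Ψ : E [⋀^Fin n]→ₗ[ℝ] ℝ) (M : Set E) (ξ : E → E) : Prop :=
  ∃ h S, IsEquiaffineNormalWith Ψ M ξ h S

/-- `M` is a connected affine sphere with affine mean curvature `H`: a connected nondegenerate
hypersurface whose affine shape operator is `H` times the identity. -/
def IsAffineSphere {n : ℕ} (Ψ : E [⋀^Fin n]→ₗ[ℝ] ℝ) (M : Set E) (H : ℝ) : Prop :=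
  IsSmoothHypersurface M ∧ IsConnected M ∧
    ∃ ξ h S, IsEquiaffineNormalWith Ψ M ξ h S ∧
      ∀ p ∈ M, ∀ X ∈ tangentVectors M p, S p X = H • X

/-- `M` is a connected improper affine sphere: its affine mean curvature vanishes. -/
def IsImproperAffineSphere {n : ℕ} (Ψ : E [⋀^Fin n]→ₗ[ℝ] ℝ) (M : Set E) : Prop :=
  IsAffineSphere Ψ M 0

end Hypersurface

end

/-!
Write `f` for the characteristic polynomial and `H = D²f + df ⊗ df`, so that the Hessian of `eᶠ` is
`eᶠ H` and the first claim says that `det H` is constant. Left symmetry makes `f` a relative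
invariant of the affine fields `x ↦ a + a * x`, of weight `tr R(a)`. If `α ≠ 0`, then
`r = α⁻¹ v` satisfies `H r = df`, and the derivative of `H` along such a field is obtained from `H`
by composing with endomorphisms on both sides; by Jacobi's formula `det H` is a relative invariant
too, of weight `(n + 1) tr R(a) - 2 tr L(a) = 0`. The fields span where `f ≠ 0`, and this set is
dense because translation along `r` shifts `f`. If `α = 0`, then `v` lies in the kernel of `H`.

At the origin `H = 2 tr R ⊗ tr R - τ`, which is `-τ` composed with a reflection in `r` and hence
nondegenerate when `τ` is. On a level set of `f` the vector `r` is `H`-orthogonal to the tangent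
space, on which `H = D²f`. So the constant field `c r` induces the second fundamental form `-c⁻¹ H`,
the constancy of `det H` is the volume normalisation for a suitable `c`, and the shape operator
vanishes because `c r` is parallel.
-/

section Determinant

variable {𝕜 ι : Type*} [NontriviallyNormedField 𝕜] [Fintype ι] [DecidableEq ι]

theorem contDiff_matrix_det {E : Type*} [NormedAddCommGroup E] [NormedSpace 𝕜 E]
    {M : E → Matrix ι ι 𝕜} {m : WithTop ℕ∞} (hM : ∀ i j, ContDiff 𝕜 m fun x => M x i j) :
    ContDiff 𝕜 m fun x => (M x).det := by
  simp only [Matrix.det_apply]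
  exact ContDiff.sum fun σ _ => (contDiff_prod fun i _ => hM (σ i) i).const_smul _

theorem hasDerivAt_matrix_det {M : 𝕜 → Matrix ι ι 𝕜} {M' : Matrix ι ι 𝕜} {t : 𝕜}
    (hM : ∀ i j, HasDerivAt (fun s => M s i j) (M' i j) t) :
    HasDerivAt (fun s => (M s).det) ((M t).adjugate * M').trace t := by
  let D : ContinuousMultilinearMap 𝕜 (fun _ : ι => ι → 𝕜) 𝕜 :=
    ⟨(Matrix.detRowAlternating (n := ι) (R := 𝕜)).toMultilinearMap,
      Continuous.matrix_det (A := fun A : Matrix ι ι 𝕜 => A) continuous_id⟩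
  have hrows : HasDerivAt (fun s i j => M s i j) (fun i j => M' i j) t :=
    hasDerivAt_pi.2 fun i => hasDerivAt_pi.2 (hM i)
  have htrace : D.linearDeriv (M t) (fun i j => M' i j) = ((M t).adjugate * M').trace := by
    refine (D.linearDeriv_apply _ _).trans ?_
    rw [Matrix.trace_mul_comm]
    refine Finset.sum_congr rfl fun i _ => ?_
    change ((M t).updateRow i (M' i)).det = ∑ j, M' i j * (M t).adjugate j i
    rw [← Matrix.cramer_transpose_apply, Matrix.cramer_eq_adjugate_mulVec,
      ← Matrix.adjugate_transpose]
    simp only [Matrix.mulVec, dotProduct, Matrix.transpose_apply, mul_comm]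
  rw [← htrace]
  exact (D.hasFDerivAt (x := fun i j => M t i j)).comp_hasDerivAt t hrows

theorem hasLineDerivAt_matrix_det_of_mul_add_mul {E : Type*} [AddCommGroup E] [Module 𝕜 E]
    {M : E → Matrix ι ι 𝕜} {B C : Matrix ι ι 𝕜} {x w : E}
    (hM : ∀ i j, HasLineDerivAt 𝕜 (fun y => M y i j) ((B * M x + M x * C) i j) x w) :
    HasLineDerivAt 𝕜 (fun y => (M y).det) ((B.trace + C.trace) * (M x).det) x w := by
  have hB : ((M x).adjugate * (B * M x)).trace = B.trace * (M x).det := by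
    rw [← Matrix.mul_assoc, Matrix.trace_mul_cycle, Matrix.mul_adjugate, Matrix.smul_mul,
      Matrix.one_mul, Matrix.trace_smul, smul_eq_mul, mul_comm]
  have hC : ((M x).adjugate * (M x * C)).trace = C.trace * (M x).det := by
    rw [← Matrix.mul_assoc, Matrix.adjugate_mul, Matrix.smul_mul, Matrix.one_mul,
      Matrix.trace_smul, smul_eq_mul, mul_comm]
  have hdet := hasDerivAt_matrix_det hM
  rwa [zero_smul, add_zero, Matrix.mul_add, Matrix.trace_add, hB, hC, ← add_mul] at hdet

end Determinant

section LinearAlgebra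

variable {R V ι : Type*} [CommRing R] [AddCommGroup V] [Module R V] [Fintype ι] [DecidableEq ι]

theorem det_eq_mul_det_of_col_eq_zero {M : Matrix ι ι R} {k : ι} (h : ∀ i, i ≠ k → M i k = 0) :
    M.det = M k k * (M.submatrix (Subtype.val : {i // i ≠ k} → ι) Subtype.val).det := by
  have hk : (M.toSquareBlockProp (fun i => i = k)).det = M k k := by
    rw [Matrix.det_unique]
    rfl
  rw [Matrix.twoBlockTriangular_det M (fun i => i = k) fun i hi j hj => hj ▸ h i hi, ← hk]
  congr!

theorem det_bilinForm_eq_sq_mul_det_toMatrix (b : Module.Basis ι R V)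
    (B : LinearMap.BilinForm R V) (X : ι → V) :
    (Matrix.of fun i j => B (X i) (X j)).det =
      b.det X ^ 2 * (LinearMap.BilinForm.toMatrix b B).det := by
  have hgram : Matrix.of (fun i j => B (X i) (X j)) =
      (b.toMatrix X).transpose * LinearMap.BilinForm.toMatrix b B * b.toMatrix X := by
    rw [LinearMap.BilinForm.mul_toMatrix_mul b b]
    ext i j
    simp [LinearMap.BilinForm.toMatrix_apply, Matrix.toLin_self, Module.Basis.toMatrix_apply,
      Module.Basis.sum_repr]
  rw [hgram, Matrix.det_mul, Matrix.det_mul, Matrix.det_transpose, b.det_apply]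
  ring

/-- The form `2 φ ⊗ φ - B` with `φ = B r` is `-B` composed with a reflection in `r`. -/
theorem eq_zero_of_two_mul_apply_mul_apply_eq {B : LinearMap.BilinForm R V}
    (hB : B.SeparatingRight) {r : V} (hr : B r r = 1) {y : V}
    (hy : ∀ x, 2 * (B r x * B r y) = B x y) : y = 0 := by
  have hry : B r y = 0 := by linear_combination hy r - 2 * B r y * hr
  exact hB y fun x => by rw [← hy x, hry, mul_zero, mul_zero]

end LinearAlgebra

section Calculus

variable {E F : Type*} [NormedAddCommGroup E] [NormedSpace ℝ E] [NormedAddCommGroup F]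
  [NormedSpace ℝ F] {g : E → F}

theorem fderiv_fderiv_apply {x : E} (hg : DifferentiableAt ℝ (fderiv ℝ g) x) (y z : E) :
    fderiv ℝ (fun u => fderiv ℝ g u z) x y = fderiv ℝ (fderiv ℝ g) x y z := by
  rw [fderiv_clm_apply hg (differentiableAt_const z)]
  simp

theorem differentiable_fderiv_of_contDiff_two (hg : ContDiff ℝ 2 g) :
    Differentiable ℝ (fderiv ℝ g) :=
  (hg.fderiv_right (m := 1) (by norm_num)).differentiable one_ne_zero

theorem fderiv_fderiv_comm (hg : ContDiff ℝ 2 g) (x y z : E) :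
    fderiv ℝ (fderiv ℝ g) x y z = fderiv ℝ (fderiv ℝ g) x z y :=
  hg.contDiffAt.isSymmSndFDerivAt (by simp) y z

theorem fderiv_fderiv_apply_affine {k : E → F} (hg : ContDiff ℝ 2 g) {a : E} {L : E →L[ℝ] E}
    (h : ∀ x, fderiv ℝ g x (a + L x) = k x) (x z : E) :
    fderiv ℝ (fderiv ℝ g) x (a + L x) z = fderiv ℝ k x z - fderiv ℝ g x (L z) := by
  have hfield : HasFDerivAt (fun x => a + L x) L x := L.hasFDerivAt.const_add a
  obtain rfl : (fun x => fderiv ℝ g x (a + L x)) = k := funext h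
  rw [fderiv_fderiv_comm hg,
    fderiv_clm_apply (differentiable_fderiv_of_contDiff_two hg x) hfield.differentiableAt,
    hfield.fderiv]
  simp

end Calculus

section RelativeInvariant

variable {E : Type*} [NormedAddCommGroup E] [NormedSpace ℝ E] {f : E → ℝ} {a : E} {L : E →L[ℝ] E}
  {t : ℝ}

theorem fderiv_fderiv_apply_of_relativeInvariant (hf : ContDiff ℝ 2 f)
    (h : ∀ x, fderiv ℝ f x (a + L x) = t * f x) (x z : E) :
    fderiv ℝ (fderiv ℝ f) x (a + L x) z = t * fderiv ℝ f x z - fderiv ℝ f x (L z) := by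
  rw [fderiv_fderiv_apply_affine hf h, fderiv_const_mul (hf.differentiable two_ne_zero x)]
  simp

theorem fderiv_fderiv_fderiv_apply_of_relativeInvariant (hf : ContDiff ℝ 3 f)
    (h : ∀ x, fderiv ℝ f x (a + L x) = t * f x) (x y z : E) :
    fderiv ℝ (fun u => fderiv ℝ (fderiv ℝ f) u y z) x (a + L x) =
      t * fderiv ℝ (fderiv ℝ f) x y z - fderiv ℝ (fderiv ℝ f) x (L y) z -
        fderiv ℝ (fderiv ℝ f) x y (L z) := by
  have hf2 : ContDiff ℝ 2 f := hf.of_le (by norm_num)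
  have hd : Differentiable ℝ (fderiv ℝ f) := differentiable_fderiv_of_contDiff_two hf2
  have hdz (w : E) : ContDiff ℝ 2 fun u => fderiv ℝ f u w :=
    (hf.fderiv_right (by norm_num)).clm_apply contDiff_const
  have hdzd (w : E) : DifferentiableAt ℝ (fun u => fderiv ℝ f u w) x :=
    (hdz w).differentiable two_ne_zero x
  have hz (u : E) : fderiv ℝ (fun u => fderiv ℝ f u z) u (a + L u) =
      t * fderiv ℝ f u z - fderiv ℝ f u (L z) := by
    rw [fderiv_fderiv_apply (hd u), fderiv_fderiv_apply_of_relativeInvariant hf2 h]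
  have hyz := fderiv_fderiv_apply_affine (hdz z) hz x y
  rw [← fderiv_fderiv_apply (differentiable_fderiv_of_contDiff_two (hdz z) x),
    fderiv_fun_sub ((hdzd z).const_mul t) (hdzd (L z)), fderiv_const_mul (hdzd z)] at hyz
  simp only [fderiv_fderiv_apply (hd _), sub_apply, smul_apply, smul_eq_mul] at hyz
  rw [hyz]
  ring

end RelativeInvariant

section ExpHess

variable {E : Type*} [NormedAddCommGroup E] [NormedSpace ℝ E] {f : E → ℝ}

/-- The bilinear form `D²f + df ⊗ df`, which is `e⁻ᶠ` times the Hessian of `eᶠ`. -/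
noncomputable def expHess (f : E → ℝ) (x : E) : LinearMap.BilinForm ℝ E :=
  (fderiv ℝ (fderiv ℝ f) x).toLinearMap₁₂ +
    (LinearMap.mul ℝ ℝ).compl₁₂ (fderiv ℝ f x : E →ₗ[ℝ] ℝ) (fderiv ℝ f x)

theorem expHess_apply (f : E → ℝ) (x y z : E) :
    expHess f x y z = fderiv ℝ (fderiv ℝ f) x y z + fderiv ℝ f x y * fderiv ℝ f x z :=
  rfl

theorem expHess_comm (hf : ContDiff ℝ 2 f) (x y z : E) : expHess f x y z = expHess f x z y := by
  rw [expHess_apply, expHess_apply, fderiv_fderiv_comm hf, mul_comm]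

theorem fderiv_fderiv_exp (hf : ContDiff ℝ 2 f) (x y z : E) :
    fderiv ℝ (fderiv ℝ fun u => Real.exp (f u)) x y z = Real.exp (f x) * expHess f x y z := by
  have hd : Differentiable ℝ f := hf.differentiable two_ne_zero
  have hd2 := differentiable_fderiv_of_contDiff_two hf
  have hexp : fderiv ℝ (fun u => Real.exp (f u)) = fun u => Real.exp (f u) • fderiv ℝ f u :=
    funext fun u => (hd u).hasFDerivAt.exp.fderiv
  rw [hexp, fderiv_fun_smul (hd x).exp (hd2 x), (hd x).hasFDerivAt.exp.fderiv, expHess_apply]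
  simp only [add_apply, smul_apply, ContinuousLinearMap.smulRight_apply, smul_eq_mul]
  ring

theorem contDiff_expHess_apply {m : WithTop ℕ∞} (hf : ContDiff ℝ (m + 2) f) (y z : E) :
    ContDiff ℝ m fun x => expHess f x y z := by
  have hdf : ContDiff ℝ (m + 1) (fderiv ℝ f) :=
    hf.fderiv_right (by rw [add_assoc, one_add_one_eq_two])
  have : ContDiff ℝ m (fderiv ℝ (fderiv ℝ f)) := hdf.fderiv_right le_rfl
  have : ContDiff ℝ m (fderiv ℝ f) := hdf.of_le le_self_add
  simp only [expHess_apply]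
  fun_prop

theorem fderiv_expHess_apply_of_relativeInvariant (hf : ContDiff ℝ 3 f) {a : E} {L : E →L[ℝ] E}
    {t : ℝ} (h : ∀ x, fderiv ℝ f x (a + L x) = t * f x) (x y z : E) :
    fderiv ℝ (fun u => expHess f u y z) x (a + L x) =
      t * (expHess f x y z + fderiv ℝ f x y * fderiv ℝ f x z) -
        expHess f x (L y) z - expHess f x y (L z) := by
  have hf2 : ContDiff ℝ 2 f := hf.of_le (by norm_num)
  have hdf : ContDiff ℝ 2 (fderiv ℝ f) := hf.fderiv_right (by norm_num)
  have hd := differentiable_fderiv_of_contDiff_two hf2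
  have hd1 (w : E) : DifferentiableAt ℝ (fun u => fderiv ℝ f u w) x :=
    (hd x).clm_apply (differentiableAt_const w)
  have hd2 : DifferentiableAt ℝ (fun u => fderiv ℝ (fderiv ℝ f) u y z) x :=
    ((differentiable_fderiv_of_contDiff_two hdf x).clm_apply
      (differentiableAt_const y)).clm_apply (differentiableAt_const z)
  simp only [expHess_apply]
  rw [fderiv_fun_add hd2 ((hd1 y).fun_mul (hd1 z)), fderiv_fun_mul (hd1 y) (hd1 z)]
  simp only [add_apply, smul_apply, smul_eq_mul, fderiv_fderiv_apply (hd x),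
    fderiv_fderiv_apply_of_relativeInvariant hf2 h,
    fderiv_fderiv_fderiv_apply_of_relativeInvariant hf h]
  ring

end ExpHess

section Translation

variable {E : Type*} [AddCommGroup E] [Module ℝ E] [TopologicalSpace E] [ContinuousAdd E]
  [ContinuousSMul ℝ E] {f : E → ℝ} {r : E}

theorem isOpenMap_of_translation (hr : ∀ (x : E) (s : ℝ), f (x + s • r) = f x + s) :
    IsOpenMap f :=
  IsOpenMap.of_sections fun x =>
    ⟨fun y => x + (y - f x) • r, by fun_prop, by simp, fun y => by simp [hr]⟩

theorem isConnected_levelSet (hf : Continuous f)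
    (hr : ∀ (x : E) (s : ℝ), f (x + s • r) = f x + s) (s : ℝ) : IsConnected {x | f x = s} := by
  have hrange : {x | f x = s} = Set.range fun x => x + (s - f x) • r := by
    ext x
    constructor
    · rintro rfl
      exact ⟨x, by simp⟩
    · rintro ⟨y, rfl⟩
      simp [hr]
  rw [hrange]
  exact isConnected_range (by fun_prop)

end Translation

theorem fderiv_apply_of_translation {E : Type*} [NormedAddCommGroup E] [NormedSpace ℝ E]
    {f : E → ℝ} {v : E} {α : ℝ} (hf : Differentiable ℝ f)
    (hv : ∀ (x : E) (s : ℝ), f (x + s • v) = f x + α * s) (x : E) : fderiv ℝ f x v = α := by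
  have hline : HasLineDerivAt ℝ f α x v := by
    simpa [HasLineDerivAt, hv] using ((hasDerivAt_id (0 : ℝ)).const_mul α).const_add (f x)
  rw [← (hf x).lineDeriv_eq_fderiv, hline.lineDeriv]

theorem apply_add_smul_inv_smul_of_translation {E : Type*} [AddCommGroup E] [Module ℝ E]
    {f : E → ℝ} {v : E} {α : ℝ} (hα : α ≠ 0) (hv : ∀ (x : E) (s : ℝ), f (x + s • v) = f x + α * s)
    (x : E) (s : ℝ) : f (x + s • α⁻¹ • v) = f x + s := by
  rw [smul_smul, hv, mul_comm s, mul_inv_cancel_left₀ hα]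

section ExpHessDet

variable {E ι : Type*} [NormedAddCommGroup E] [NormedSpace ℝ E] [Fintype ι] [DecidableEq ι]
  {f : E → ℝ}

theorem fderiv_fderiv_apply_of_fderiv_apply_eq (hf : ContDiff ℝ 2 f) {v : E} {α : ℝ}
    (hv : ∀ x, fderiv ℝ f x v = α) (x y : E) : fderiv ℝ (fderiv ℝ f) x y v = 0 := by
  rw [← fderiv_fderiv_apply (differentiable_fderiv_of_contDiff_two hf x), funext hv,
    fderiv_fun_const]
  rfl

theorem expHess_apply_of_fderiv_apply_eq (hf : ContDiff ℝ 2 f) {v : E} {α : ℝ}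
    (hv : ∀ x, fderiv ℝ f x v = α) (x y : E) : expHess f x y v = fderiv ℝ f x y * α := by
  rw [expHess_apply, fderiv_fderiv_apply_of_fderiv_apply_eq hf hv, hv, zero_add]

/-- The determinant of `D²f + df ⊗ df` in the basis `b`; it is `e⁻ⁿᶠ` times the Hessian determinant
of `eᶠ`, where `n` is the dimension. -/
noncomputable def expHessDet (b : Module.Basis ι ℝ E) (f : E → ℝ) (x : E) : ℝ :=
  (LinearMap.BilinForm.toMatrix b (expHess f x)).det

theorem hessianDet_exp {n : ℕ} {f : (Fin n → ℝ) → ℝ} (hf : ContDiff ℝ 2 f) (x : Fin n → ℝ) :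
    hessianDet (fun u => Real.exp (f u)) x =
      expHessDet (Pi.basisFun ℝ (Fin n)) f x * Real.exp (n * f x) := by
  have hmatrix : (Matrix.of fun i j : Fin n => fderiv ℝ (fderiv ℝ fun u => Real.exp (f u)) x
      (Pi.single i 1) (Pi.single j 1)) =
      Real.exp (f x) • LinearMap.BilinForm.toMatrix (Pi.basisFun ℝ (Fin n)) (expHess f x) := by
    ext i j
    simp [fderiv_fderiv_exp hf, LinearMap.BilinForm.toMatrix_apply]
  rw [hessianDet, hmatrix, Matrix.det_smul, expHessDet, Fintype.card_fin, ← Real.exp_nat_mul,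
    mul_comm]

variable (b : Module.Basis ι ℝ E)

theorem expHessDet_ne_zero_iff {x : E} : expHessDet b f x ≠ 0 ↔ (expHess f x).Nondegenerate :=
  (LinearMap.BilinForm.nondegenerate_iff_det_ne_zero b).symm

theorem expHessDet_eq_zero_of_fderiv_apply_eq_zero (hf : ContDiff ℝ 2 f) {v : E} (hv0 : v ≠ 0)
    (hv : ∀ x, fderiv ℝ f x v = 0) (x : E) : expHessDet b f x = 0 := by
  by_contra hdet
  refine hv0 (((expHessDet_ne_zero_iff b).1 hdet).2 v fun y => ?_)
  rw [expHess_apply_of_fderiv_apply_eq hf hv, mul_zero]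

theorem contDiff_expHessDet {m : WithTop ℕ∞} (hf : ContDiff ℝ (m + 2) f) :
    ContDiff ℝ m (expHessDet b f) :=
  contDiff_matrix_det fun i j => by
    simpa only [LinearMap.BilinForm.toMatrix_apply] using contDiff_expHess_apply hf (b i) (b j)

theorem hasLineDerivAt_expHessDet_of_relativeInvariant (hf : ContDiff ℝ 3 f) {r : E}
    (hr : ∀ x, fderiv ℝ f x r = 1) {a : E} {L : E →L[ℝ] E} {t : ℝ}
    (h : ∀ x, fderiv ℝ f x (a + L x) = t * f x) (x : E) :
    HasLineDerivAt ℝ (expHessDet b f)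
      (((Fintype.card ι + 1) * t - 2 * LinearMap.trace ℝ E L) * expHessDet b f x) x (a + L x) := by
  -- Since `df = expHess f x · r`, the term `t df ⊗ df` is a composition of `expHess f x` with an
  -- endomorphism of rank one.
  let C : E →ₗ[ℝ] E := t • 1 + t • (fderiv ℝ f x : E →ₗ[ℝ] ℝ).smulRight r - L
  have hform (y z : E) : fderiv ℝ (fun u => expHess f u y z) x (a + L x) =
      ((expHess f x).compLeft (-(L : E →ₗ[ℝ] E)) + (expHess f x).compRight C) y z := by
    rw [fderiv_expHess_apply_of_relativeInvariant hf h]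
    simp only [LinearMap.add_apply, LinearMap.BilinForm.compLeft_apply, LinearMap.neg_apply,
      ContinuousLinearMap.coe_coe, map_neg, LinearMap.BilinForm.compRight_apply,
      LinearMap.sub_apply, LinearMap.smul_apply, Module.End.one_apply, LinearMap.coe_smulRight,
      map_sub, map_add, map_smul, smul_eq_mul,
      expHess_apply_of_fderiv_apply_eq (hf.of_le (by norm_num)) hr, mul_one, C]
    ring
  have hentry (i j : ι) : HasLineDerivAt ℝ
      (fun u => LinearMap.BilinForm.toMatrix b (expHess f u) i j)
      (((LinearMap.toMatrix b b (-(L : E →ₗ[ℝ] E))).transpose *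
        LinearMap.BilinForm.toMatrix b (expHess f x) +
          LinearMap.BilinForm.toMatrix b (expHess f x) * LinearMap.toMatrix b b C) i j)
      x (a + L x) := by
    rw [← LinearMap.BilinForm.toMatrix_compLeft b, ← LinearMap.BilinForm.toMatrix_compRight b,
      ← map_add, LinearMap.BilinForm.toMatrix_apply, ← hform]
    simp only [LinearMap.BilinForm.toMatrix_apply]
    exact ((contDiff_expHess_apply (m := 1) (hf.of_le (by norm_num)) _ _).differentiable
      one_ne_zero x).hasFDerivAt.hasLineDerivAt _
  have htrace : (LinearMap.toMatrix b b (-(L : E →ₗ[ℝ] E))).transpose.trace +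
      (LinearMap.toMatrix b b C).trace =
      (Fintype.card ι + 1) * t - 2 * LinearMap.trace ℝ E L := by
    have : Module.Finite ℝ E := Module.Finite.of_basis b
    have hdim : Module.finrank ℝ E = Fintype.card ι := Module.finrank_eq_card_basis b
    rw [Matrix.trace_transpose, ← LinearMap.trace_eq_matrix_trace,
      ← LinearMap.trace_eq_matrix_trace]
    simp only [C, map_neg, map_sub, map_add, map_smul, LinearMap.trace_one, hdim,
      LinearMap.trace_smulRight, ContinuousLinearMap.coe_coe, hr, smul_eq_mul]
    ring
  rw [← htrace]
  exact hasLineDerivAt_matrix_det_of_mul_add_mul hentry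

theorem expHessDet_eq_of_relativeInvariant (hf : ContDiff ℝ 3 f) {r : E}
    (hr : ∀ (x : E) (s : ℝ), f (x + s • r) = f x + s) {I : Type*} {a : I → E} {L : I → E →L[ℝ] E}
    {t : I → ℝ} (h : ∀ i x, fderiv ℝ f x (a i + L i x) = t i * f x)
    (ht : ∀ i, 2 * LinearMap.trace ℝ E (L i) = (Fintype.card ι + 1) * t i)
    (hsurj : ∀ x, f x ≠ 0 → Function.Surjective fun i => a i + L i x) (x y : E) :
    expHessDet b f x = expHessDet b f y := by
  have hdr (x : E) : fderiv ℝ f x r = 1 :=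
    fderiv_apply_of_translation (hf.differentiable three_ne_zero) (by simpa using hr) x
  have hdet : ContDiff ℝ 1 (expHessDet b f) := contDiff_expHessDet b (hf.of_le (by norm_num))
  have hdetd : Differentiable ℝ (expHessDet b f) := hdet.differentiable one_ne_zero
  have hopen : Set.EqOn (fderiv ℝ (expHessDet b f)) 0 (f ⁻¹' {0}ᶜ) := fun x hx => by
    ext w
    obtain ⟨i, rfl⟩ := hsurj x hx w
    rw [← (hdetd x).lineDeriv_eq_fderiv,
      (hasLineDerivAt_expHessDet_of_relativeInvariant b hf hdr (h i) x).lineDeriv, ht, sub_self,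
      zero_mul]
    rfl
  have hdense : Dense (f ⁻¹' {0}ᶜ) :=
    (dense_compl_singleton 0).preimage (isOpenMap_of_translation hr)
  have hzero : fderiv ℝ (expHessDet b f) = 0 :=
    (hdet.continuous_fderiv one_ne_zero).ext_on hdense continuous_zero hopen
  exact is_const_of_fderiv_eq_zero hdetd (congrFun hzero) x y

end ExpHessDet

section TangentVectors

variable {E F : Type*} [NormedAddCommGroup E] [NormedSpace ℝ E] [NormedAddCommGroup F]
  [NormedSpace ℝ F]

theorem fderiv_apply_eq_zero_of_mem_tangentVectors {M : Set E} {p X : E} {g : E → F} {c : F}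
    (hg : DifferentiableAt ℝ g p) (hgM : ∀ᶠ q in 𝓝[M] p, g q = c) (hX : X ∈ tangentVectors M p) :
    fderiv ℝ g p X = 0 := by
  obtain ⟨γ, hγ, rfl, hγM, rfl⟩ := hX
  have hγ' : HasDerivAt γ (deriv γ 0) 0 := (hγ.differentiableAt (by simp)).hasDerivAt
  have hlim : Filter.Tendsto γ (𝓝 0) (𝓝[M] γ 0) :=
    tendsto_nhdsWithin_iff.2 ⟨hγ'.continuousAt, hγM⟩
  have hconst : g ∘ γ =ᶠ[𝓝 0] fun _ => c := hlim.eventually hgM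
  exact (hg.hasFDerivAt.comp_hasDerivAt 0 hγ').unique
    ((hasDerivAt_const 0 c).congr_of_eventuallyEq hconst)

end TangentVectors

section LevelSet

variable {E : Type*} [NormedAddCommGroup E] [NormedSpace ℝ E] {f : E → ℝ} {r : E} {s c : ℝ}

theorem isSmoothHypersurface_levelSet (hf : ContDiff ℝ ∞ f)
    (hreg : ∀ x, f x = s → fderiv ℝ f x ≠ 0) : IsSmoothHypersurface {x | f x = s} := fun p hp =>
  ⟨Set.univ, fun x => f x - s, isOpen_univ, trivial, (hf.sub contDiff_const).contDiffOn,
    by rw [fderiv_sub_const]; exact hreg p hp, by ext; simp [sub_eq_zero]⟩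

theorem mem_tangentVectors_levelSet_iff (hf : ContDiff ℝ ∞ f)
    (hr : ∀ (x : E) (s : ℝ), f (x + s • r) = f x + s) {p : E} (hp : f p = s) {X : E} :
    X ∈ tangentVectors {x | f x = s} p ↔ fderiv ℝ f p X = 0 := by
  have hd : DifferentiableAt ℝ f p := hf.differentiable (by simp) p
  refine ⟨fderiv_apply_eq_zero_of_mem_tangentVectors hd self_mem_nhdsWithin, fun hX => ?_⟩
  have hline : ContDiff ℝ ∞ fun t : ℝ => p + t • X := by fun_prop
  have hfline : HasLineDerivAt ℝ f 0 p X := hX ▸ hd.hasFDerivAt.hasLineDerivAt X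
  -- The projection of the line `p + t • X` to the level set along `r`.
  refine ⟨fun t => p + t • X + (s - f (p + t • X)) • r,
    (hline.add ((contDiff_const.sub (hf.comp hline)).smul contDiff_const)).contDiffAt,
    by simp [hp], Filter.Eventually.of_forall fun t => by simp [hr], ?_⟩
  have hlineX : HasDerivAt (fun t : ℝ => p + t • X) X 0 := by
    simpa using ((hasDerivAt_id (0 : ℝ)).smul_const X).const_add p
  simpa using (hlineX.fun_add ((HasDerivAt.const_sub s hfline).smul_const r)).deriv

theorem fderiv_apply_of_rate_one_translation (hf : ContDiff ℝ ∞ f)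
    (hr : ∀ (x : E) (s : ℝ), f (x + s • r) = f x + s) (x : E) : fderiv ℝ f x r = 1 :=
  fderiv_apply_of_translation (hf.differentiable (by simp)) (by simpa using hr) x

theorem isTransversal_levelSet (hf : ContDiff ℝ ∞ f)
    (hr : ∀ (x : E) (s : ℝ), f (x + s • r) = f x + s) (hc : c ≠ 0) :
    IsTransversal {x | f x = s} fun _ => c • r := by
  refine ⟨⟨Set.univ, isOpen_univ, Set.subset_univ _, contDiffOn_const⟩, fun p hp h => hc ?_⟩
  rw [mem_tangentVectors_levelSet_iff hf hr hp, map_smul,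
    fderiv_apply_of_rate_one_translation hf hr] at h
  simpa using h

theorem isInducedBy_levelSet (hf : ContDiff ℝ ∞ f)
    (hr : ∀ (x : E) (s : ℝ), f (x + s • r) = f x + s) (hc : c ≠ 0) :
    IsInducedBy {x | f x = s} (fun _ => c • r)
      (fun p X Y => -c⁻¹ * fderiv ℝ (fderiv ℝ f) p X Y) (fun _ _ => 0) (fun _ _ => 0) where
  gauss p hp X hX Y hY hYM := by
    have hd : DifferentiableAt ℝ (fderiv ℝ f) p :=
      differentiable_fderiv_of_contDiff_two (contDiff_infty.1 hf 2) p
    have hdY : DifferentiableAt ℝ Y p := hY.differentiableAt (by simp)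
    have htangent : ∀ᶠ q in 𝓝[{x | f x = s}] p, fderiv ℝ f q (Y q) = 0 := by
      filter_upwards [hYM, self_mem_nhdsWithin] with q hq hqs
      exact (mem_tangentVectors_levelSet_iff hf hr hqs).1 hq
    have hderiv : fderiv ℝ f p (fderiv ℝ Y p X) + fderiv ℝ (fderiv ℝ f) p X (Y p) = 0 := by
      have := fderiv_apply_eq_zero_of_mem_tangentVectors (hd.clm_apply hdY) htangent hX
      rwa [fderiv_clm_apply hd hdY] at this
    rw [mem_tangentVectors_levelSet_iff hf hr hp, map_sub, map_smul, map_smul,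
      fderiv_apply_of_rate_one_translation hf hr, smul_eq_mul, smul_eq_mul, mul_one,
      mul_right_comm, neg_mul, inv_mul_cancel₀ hc]
    linear_combination hderiv
  shape_tangent p hp X _ := by rw [mem_tangentVectors_levelSet_iff hf hr hp, map_zero]
  weingarten p _ X _ := by simp

theorem isNondegenerateOn_levelSet (hf : ContDiff ℝ ∞ f)
    (hr : ∀ (x : E) (s : ℝ), f (x + s • r) = f x + s) (hc : c ≠ 0)
    (hH : ∀ p, f p = s → (expHess f p).Nondegenerate) :
    IsNondegenerateOn {x | f x = s} fun p X Y => -c⁻¹ * fderiv ℝ (fderiv ℝ f) p X Y := by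
  intro p hp X hX hXY
  have hdr := fderiv_apply_of_rate_one_translation hf hr
  rw [mem_tangentVectors_levelSet_iff hf hr hp] at hX
  refine (hH p hp).1 X fun Z => ?_
  have hZ : -c⁻¹ * fderiv ℝ (fderiv ℝ f) p X (Z - fderiv ℝ f p Z • r) = 0 := hXY _ (by
    rw [mem_tangentVectors_levelSet_iff hf hr hp, map_sub, map_smul, hdr, smul_eq_mul, mul_one,
      sub_self])
  rw [map_sub, map_smul, fderiv_fderiv_apply_of_fderiv_apply_eq (contDiff_infty.1 hf 2) hdr,
    smul_zero, sub_zero] at hZ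
  rw [expHess_apply, hX, zero_mul, add_zero]
  exact (mul_eq_zero.1 hZ).resolve_left (neg_ne_zero.2 (inv_ne_zero hc))

theorem sq_det_mul_expHessDet {ι : Type*} [Fintype ι] [DecidableEq ι] (b : Module.Basis ι ℝ E)
    (hf : ContDiff ℝ 2 f) (hr : ∀ x, fderiv ℝ f x r = 1) (hc : c ≠ 0) {p : E} {i₀ : ι} {X : ι → E}
    (hX₀ : X i₀ = c • r) (hX : ∀ i, i ≠ i₀ → fderiv ℝ f p (X i) = 0) :
    b.det X ^ 2 * expHessDet b f p = c ^ 2 * ((-c) ^ (Fintype.card ι - 1) *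
      (Matrix.of fun i j : {i // i ≠ i₀} =>
        -c⁻¹ * fderiv ℝ (fderiv ℝ f) p (X i) (X j)).det) := by
  have hcol (i : ι) : expHess f p (X i) (X i₀) = c * fderiv ℝ f p (X i) := by
    rw [hX₀, map_smul, expHess_apply_of_fderiv_apply_eq hf hr, mul_one, smul_eq_mul]
  have hdiag : expHess f p (X i₀) (X i₀) = c ^ 2 := by
    rw [hcol, hX₀, map_smul, hr, smul_eq_mul, mul_one, sq]
  have hblock : (Matrix.of fun i j => expHess f p (X i) (X j)).submatrix
      (Subtype.val : {i // i ≠ i₀} → ι) Subtype.val =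
      (-c) • Matrix.of fun i j : {i // i ≠ i₀} =>
        -c⁻¹ * fderiv ℝ (fderiv ℝ f) p (X i) (X j) := by
    ext i j
    simp [expHess_apply, hX i i.2, hc]
  rw [expHessDet, ← det_bilinForm_eq_sq_mul_det_toMatrix, det_eq_mul_det_of_col_eq_zero (k := i₀)
    fun i hi => by rw [Matrix.of_apply, hcol, hX i hi, mul_zero], hblock, Matrix.det_smul,
    Matrix.of_apply, hdiag, Fintype.card_subtype_compl, Fintype.card_subtype_eq]

theorem isVolumeNormalized_levelSet {n : ℕ} (b : Module.Basis (Fin n) ℝ E) (hf : ContDiff ℝ ∞ f)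
    (hr : ∀ (x : E) (s : ℝ), f (x + s • r) = f x + s) (hc : c ≠ 0)
    (hdet : ∀ p, f p = s → |expHessDet b f p| = |c| ^ (n + 1)) :
    IsVolumeNormalized b.det {x | f x = s} (fun _ => c • r)
      fun p X Y => -c⁻¹ * fderiv ℝ (fderiv ℝ f) p X Y := by
  intro p hp i₀ X hX₀ hX
  have hn : 2 + (n - 1) = n + 1 := by have := i₀.pos; lia
  have hsq := congrArg abs (sq_det_mul_expHessDet b (contDiff_infty.1 hf 2)
    (fderiv_apply_of_rate_one_translation hf hr) hc hX₀ fun i hi =>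
      (mem_tangentVectors_levelSet_iff hf hr hp).1 (hX i hi))
  rw [abs_mul, abs_mul, abs_mul, abs_of_nonneg (sq_nonneg (b.det X)), hdet p hp, Fintype.card_fin,
    abs_pow c, abs_pow (-c), abs_neg, ← mul_assoc, ← pow_add, hn,
    mul_comm] at hsq
  exact mul_left_cancel₀ (pow_ne_zero _ (abs_ne_zero.2 hc)) hsq

theorem isEquiaffineNormalWith_levelSet {n : ℕ} (b : Module.Basis (Fin n) ℝ E)
    (hf : ContDiff ℝ ∞ f) (hr : ∀ (x : E) (s : ℝ), f (x + s • r) = f x + s) (hc : c ≠ 0)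
    (hdet : ∀ p, f p = s → |expHessDet b f p| = |c| ^ (n + 1)) :
    IsEquiaffineNormalWith b.det {x | f x = s} (fun _ => c • r)
      (fun p X Y => -c⁻¹ * fderiv ℝ (fderiv ℝ f) p X Y) (fun _ _ => 0) where
  transversal := isTransversal_levelSet hf hr hc
  induced := isInducedBy_levelSet hf hr hc
  nondegenerate := isNondegenerateOn_levelSet hf hr hc fun p hp =>
    (expHessDet_ne_zero_iff b).1 <| abs_ne_zero.1 <| by
      rw [hdet p hp]
      exact pow_ne_zero _ (abs_ne_zero.2 hc)
  volume := isVolumeNormalized_levelSet b hf hr hc hdet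

theorem exists_isEquiaffineNormalWith_levelSet {n : ℕ} (b : Module.Basis (Fin n) ℝ E)
    (hf : ContDiff ℝ ∞ f) (hr : ∀ (x : E) (s : ℝ), f (x + s • r) = f x + s) {κ : ℝ} (hκ : κ ≠ 0)
    (hdet : ∀ p, f p = s → expHessDet b f p = κ) :
    ∃ c : ℝ, c ≠ 0 ∧ ∃ h, IsEquiaffineNormalWith b.det {x | f x = s} (fun _ => c • r) h
      fun _ _ => 0 := by
  have hpos : 0 < |κ| ^ ((n + 1 : ℕ) : ℝ)⁻¹ := Real.rpow_pos_of_pos (abs_pos.2 hκ) _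
  refine ⟨_, hpos.ne', _, isEquiaffineNormalWith_levelSet b hf hr hpos.ne' fun p hp => ?_⟩
  rw [hdet p hp, abs_of_pos hpos, Real.rpow_inv_natCast_pow (abs_nonneg κ) n.succ_ne_zero]

theorem isImproperAffineSphere_levelSet {n : ℕ} (b : Module.Basis (Fin n) ℝ E)
    (hf : ContDiff ℝ ∞ f) (hr : ∀ (x : E) (s : ℝ), f (x + s • r) = f x + s) {κ : ℝ} (hκ : κ ≠ 0)
    (hdet : ∀ p, f p = s → expHessDet b f p = κ) :
    IsImproperAffineSphere b.det {x | f x = s} := by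
  obtain ⟨c, -, h, hnormal⟩ := exists_isEquiaffineNormalWith_levelSet b hf hr hκ hdet
  have hreg (x : E) (_ : f x = s) : fderiv ℝ f x ≠ 0 := fun h0 => by
    simpa [h0] using fderiv_apply_of_rate_one_translation hf hr x
  exact ⟨isSmoothHypersurface_levelSet hf hreg, isConnected_levelSet hf.continuous hr s,
    _, h, _, hnormal, fun _ _ X _ => (zero_smul ℝ X).symm⟩

end LevelSet

section LeftSymmetricAlgebra

variable {A : Type*} [LeftPreLieRing A] [LeftPreLieAlgebra ℝ A]

theorem lsaRight_mul (a x : A) :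
    lsaRight A (a * x) = lsaRight A x * lsaRight A a +
      (lsaLeft A a * lsaRight A x - lsaRight A x * lsaLeft A a) := by
  ext z
  have hassoc : z * a * x - z * (a * x) = a * z * x - a * (z * x) :=
    LeftPreLieRing.assoc_symm z a x
  change z * (a * x) = z * a * x + (a * (z * x) - a * z * x)
  rw [← sub_sub_self (z * a * x) (z * (a * x)), hassoc]
  abel

theorem lsaTraceForm_comm (a x : A) : lsaTraceForm A a x = lsaTraceForm A x a :=
  LinearMap.trace_mul_comm ℝ (lsaRight A a) (lsaRight A x)

theorem lsaTraceRight_mul (a x : A) : lsaTraceRight A (a * x) = lsaTraceForm A a x := by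
  change LinearMap.trace ℝ A (lsaRight A (a * x)) =
    LinearMap.trace ℝ A (lsaRight A a * lsaRight A x)
  rw [lsaRight_mul, map_add, map_sub, LinearMap.trace_mul_comm ℝ (lsaLeft A a), sub_self, add_zero,
    LinearMap.trace_mul_comm]

theorem isRightPrincipalIdempotent_of_separatingRight (hτ : (lsaTraceForm A).SeparatingRight)
    {r : A} (hr : ∀ x, lsaTraceRight A x = lsaTraceForm A r x) :
    IsRightPrincipalIdempotent A r := by
  refine ⟨sub_eq_zero.1 (hτ _ fun x => ?_), hr⟩
  -- Apply `tr R` to the symmetry of the associator `(r, x, r)` in its first two arguments.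
  have hassoc := congrArg (lsaTraceRight A) (LeftPreLieRing.assoc_symm r x r)
  simp only [associator_apply, map_sub, lsaTraceRight_mul] at hassoc
  rw [lsaTraceForm_comm (r * x), lsaTraceForm_comm (x * r), ← hr, ← hr, lsaTraceRight_mul,
    lsaTraceRight_mul, lsaTraceForm_comm x r] at hassoc
  rw [map_sub, lsaTraceForm_comm x r]
  linarith

theorem lsaCharPoly_zero : lsaCharPoly A 0 = 1 := by
  rw [lsaCharPoly, map_zero, add_zero, map_one]

variable [FiniteDimensional ℝ A]

theorem surjective_add_mul_of_lsaCharPoly_ne_zero {x : A} (hx : lsaCharPoly A x ≠ 0) :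
    Function.Surjective fun a => a + a * x :=
  ((Module.End.isUnit_iff _).1 ((LinearMap.isUnit_iff_isUnit_det _).2 hx.isUnit)).2

theorem hasLineDerivAt_lsaCharPoly (a x : A) :
    HasLineDerivAt ℝ (lsaCharPoly A) (lsaTraceRight A a * lsaCharPoly A x) x (a + a * x) := by
  let b := Module.finBasis ℝ A
  let M (y : A) := LinearMap.toMatrix b b (1 + lsaRight A y)
  have hdet (y : A) : (M y).det = lsaCharPoly A y := LinearMap.det_toMatrix b _
  have hright : lsaRight A (a + a * x) =
      lsaLeft A a * (1 + lsaRight A x) + (1 + lsaRight A x) * (lsaRight A a - lsaLeft A a) := by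
    rw [map_add, lsaRight_mul]
    noncomm_ring
  have hentry (i j) : HasLineDerivAt ℝ (fun y => M y i j)
      ((LinearMap.toMatrix b b (lsaLeft A a) * M x +
        M x * LinearMap.toMatrix b b (lsaRight A a - lsaLeft A a)) i j) x (a + a * x) := by
    rw [← LinearMap.toMatrix_mul, ← LinearMap.toMatrix_mul, ← map_add, ← hright]
    generalize a + a * x = w
    simpa [HasLineDerivAt, M, add_assoc] using
      (hasDerivAt_mul_const (LinearMap.toMatrix b b (lsaRight A w) i j)).const_add (M x i j)
  have htrace : (LinearMap.toMatrix b b (lsaLeft A a)).trace +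
      (LinearMap.toMatrix b b (lsaRight A a - lsaLeft A a)).trace = lsaTraceRight A a := by
    rw [← LinearMap.trace_eq_matrix_trace, ← LinearMap.trace_eq_matrix_trace, map_sub,
      add_sub_cancel]
    rfl
  simpa only [hdet, htrace] using hasLineDerivAt_matrix_det_of_mul_add_mul hentry

end LeftSymmetricAlgebra

section Chart

variable {A E : Type*} [LeftPreLieRing A] [LeftPreLieAlgebra ℝ A] [NormedAddCommGroup E]
  [NormedSpace ℝ E] [FiniteDimensional ℝ E] (e : E ≃ₗ[ℝ] A)

/-- The left multiplication of an algebra `A`, transported to a normed space along a linear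
isomorphism. -/
noncomputable def chartLeft (a : E) : E →L[ℝ] E :=
  LinearMap.toContinuousLinearMap (e.symm.conj (lsaLeft A (e a)))

theorem apply_chartLeft (a x : E) : e (chartLeft e a x) = e a * e x := by
  simp [chartLeft, LinearEquiv.conj_apply, lsaLeft]

theorem trace_chartLeft (a : E) :
    LinearMap.trace ℝ E (chartLeft e a) = lsaTraceLeft A (e a) :=
  LinearMap.trace_conj' _ _

theorem contDiff_lsaCharPoly {m : WithTop ℕ∞} : ContDiff ℝ m fun x => lsaCharPoly A (e x) := by
  have := e.finiteDimensional
  let b := Module.finBasis ℝ A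
  have hdet (x : E) : lsaCharPoly A (e x) = (LinearMap.toMatrix b b (1 + lsaRight A (e x))).det :=
    (LinearMap.det_toMatrix b _).symm
  have hentry (i j) : ContDiff ℝ m fun x => LinearMap.toMatrix b b (lsaRight A (e x)) i j :=
    (LinearMap.toContinuousLinearMap (Matrix.entryLinearMap ℝ ℝ i j ∘ₗ
      (LinearMap.toMatrix b b).toLinearMap ∘ₗ lsaRight A ∘ₗ e.toLinearMap)).contDiff
  simp only [hdet, map_add]
  exact contDiff_matrix_det fun i j => contDiff_const.add (hentry i j)

theorem fderiv_lsaCharPoly_apply (a x : E) :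
    fderiv ℝ (fun y => lsaCharPoly A (e y)) x (a + chartLeft e a x) =
      lsaTraceRight A (e a) * lsaCharPoly A (e x) := by
  have := e.finiteDimensional
  have hline : HasLineDerivAt ℝ (fun y => lsaCharPoly A (e y))
      (lsaTraceRight A (e a) * lsaCharPoly A (e x)) x (a + chartLeft e a x) := by
    simpa only [HasLineDerivAt, map_add, map_smul, apply_chartLeft] using
      hasLineDerivAt_lsaCharPoly (e a) (e x)
  rw [← ((contDiff_lsaCharPoly e).differentiable one_ne_zero x).lineDeriv_eq_fderiv,
    hline.lineDeriv]

theorem fderiv_lsaCharPoly_zero (a : E) :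
    fderiv ℝ (fun y => lsaCharPoly A (e y)) 0 a = lsaTraceRight A (e a) := by
  simpa [lsaCharPoly_zero] using fderiv_lsaCharPoly_apply e a 0

theorem fderiv_fderiv_lsaCharPoly_zero (a z : E) :
    fderiv ℝ (fderiv ℝ fun y => lsaCharPoly A (e y)) 0 a z =
      lsaTraceRight A (e a) * lsaTraceRight A (e z) - lsaTraceForm A (e a) (e z) := by
  have h := fderiv_fderiv_apply_of_relativeInvariant (contDiff_lsaCharPoly e)
    (fderiv_lsaCharPoly_apply e a) 0 z
  rwa [map_zero, add_zero, fderiv_lsaCharPoly_zero, fderiv_lsaCharPoly_zero, apply_chartLeft,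
    lsaTraceRight_mul] at h

theorem expHess_lsaCharPoly_zero (a z : E) :
    expHess (fun y => lsaCharPoly A (e y)) 0 a z =
      2 * (lsaTraceRight A (e a) * lsaTraceRight A (e z)) - lsaTraceForm A (e a) (e z) := by
  rw [expHess_apply, fderiv_fderiv_lsaCharPoly_zero, fderiv_lsaCharPoly_zero,
    fderiv_lsaCharPoly_zero]
  ring

theorem nondegenerate_expHess_lsaCharPoly_zero (hτ : (lsaTraceForm A).SeparatingRight) {r : A}
    (hr : ∀ x, lsaTraceRight A x = lsaTraceForm A r x) (hr1 : lsaTraceRight A r = 1) :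
    (expHess (fun y => lsaCharPoly A (e y)) 0).Nondegenerate := by
  have hright : (expHess (fun y => lsaCharPoly A (e y)) 0).SeparatingRight := fun z hz =>
    e.map_eq_zero_iff.1 <| eq_zero_of_two_mul_apply_mul_apply_eq hτ ((hr r).symm.trans hr1)
      fun x => by
        have := hz (e.symm x)
        rwa [expHess_lsaCharPoly_zero, e.apply_symm_apply, sub_eq_zero, hr, hr] at this
  exact ⟨fun y hy => hright y fun x => expHess_comm (contDiff_lsaCharPoly e) 0 y x ▸ hy x, hright⟩

end Chart

theorem expHessDet_lsaCharPoly_eq {A E ι : Type*} [LeftPreLieRing A] [LeftPreLieAlgebra ℝ A]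
    [NormedAddCommGroup E] [NormedSpace ℝ E] [Fintype ι] [DecidableEq ι] (e : E ≃ₗ[ℝ] A)
    (b : Module.Basis ι ℝ E) {v : A} {α : ℝ} (hv0 : v ≠ 0)
    (hv : ∀ (x : A) (t : ℝ), lsaCharPoly A (x + t • v) = lsaCharPoly A x + α * t)
    (hLR : ∀ x : A, 2 * lsaTraceLeft A x = (Fintype.card ι + 1) * lsaTraceRight A x) (x y : E) :
    expHessDet b (fun y => lsaCharPoly A (e y)) x =
      expHessDet b (fun y => lsaCharPoly A (e y)) y := by
  have := b.finiteDimensional_of_finite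
  have := e.finiteDimensional
  by_cases hα : α = 0
  · have hdv := fderiv_apply_of_translation (f := fun y => lsaCharPoly A (e y)) (v := e.symm v)
      ((contDiff_lsaCharPoly e).differentiable one_ne_zero) (α := α)
      (fun y s => by simp [hv])
    have hzero := expHessDet_eq_zero_of_fderiv_apply_eq_zero b (contDiff_lsaCharPoly e)
      (e.symm.map_ne_zero_iff.2 hv0) (hα ▸ hdv)
    rw [hzero, hzero]
  · refine expHessDet_eq_of_relativeInvariant b (contDiff_lsaCharPoly e) (r := e.symm (α⁻¹ • v))
      (fun y s => by
        rw [map_add, map_smul, e.apply_symm_apply, apply_add_smul_inv_smul_of_translation hα hv])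
      (fderiv_lsaCharPoly_apply e)
      (fun a => by rw [trace_chartLeft, hLR]) (fun x hx w => ?_) x y
    obtain ⟨a, ha⟩ := surjective_add_mul_of_lsaCharPoly_ne_zero hx (e w)
    exact ⟨e.symm a, e.injective (by simpa [apply_chartLeft] using ha)⟩

section CharPolyTranslation

variable {A : Type*} [LeftPreLieRing A] [LeftPreLieAlgebra ℝ A] [FiniteDimensional ℝ A] {v : A}
  {α : ℝ}

theorem lsaTraceRight_of_translation
    (hv : ∀ (x : A) (t : ℝ), lsaCharPoly A (x + t • v) = lsaCharPoly A x + α * t) :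
    lsaTraceRight A v = α := by
  have hvP : HasLineDerivAt ℝ (lsaCharPoly A) (lsaTraceRight A v) 0 v := by
    simpa [lsaCharPoly_zero] using hasLineDerivAt_lsaCharPoly v 0
  have hvα : HasLineDerivAt ℝ (lsaCharPoly A) α 0 v := by
    simpa only [HasLineDerivAt, hv] using (hasDerivAt_const_mul α).const_add _
  exact hvP.unique hvα

theorem lsaTraceForm_apply_of_translation
    (hv : ∀ (x : A) (t : ℝ), lsaCharPoly A (x + t • v) = lsaCharPoly A x + α * t) (x : A) :
    lsaTraceForm A v x = α * lsaTraceRight A x := by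
  let e := (Module.finBasis ℝ A).equivFun.symm
  have hdv := fderiv_apply_of_translation (f := fun y => lsaCharPoly A (e y)) (v := e.symm v)
    (α := α) ((contDiff_lsaCharPoly e).differentiable one_ne_zero) (fun y s => by simp [hv])
  have hd2v := fderiv_fderiv_apply_of_fderiv_apply_eq (contDiff_lsaCharPoly e) hdv 0 (e.symm x)
  rw [fderiv_fderiv_lsaCharPoly_zero, e.apply_symm_apply, e.apply_symm_apply,
    lsaTraceRight_of_translation hv, lsaTraceForm_comm] at hd2v
  linarith

end CharPolyTranslation

/-- `b` is any basis of the algebra `A`; it provides equiaffine coordinates `Fin n → ℝ` on `A` for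
the parallel volume form that is `1` on `b`, and every parallel volume form arises in this way. -/
theorem mainTheorem5 {A : Type*} [LeftPreLieRing A] [LeftPreLieAlgebra ℝ A] {n : ℕ}
    (b : Module.Basis (Fin n) ℝ A) (v : A) (hv : v ≠ 0) (α : ℝ)
    (hP : ∀ (x : A) (t : ℝ), lsaCharPoly A (x + t • v) = lsaCharPoly A x + α * t)
    (hLR : ∀ x : A, 2 * lsaTraceLeft A x = ((n : ℝ) + 1) * lsaTraceRight A x) :
    ∃ κ : ℝ,
      (∀ x : Fin n → ℝ,
        hessianDet (fun y => Real.exp (lsaCharPoly A (b.equivFun.symm y))) x =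
          κ * Real.exp (n * lsaCharPoly A (b.equivFun.symm x))) ∧
      ((lsaTraceForm A).Nondegenerate →
        κ ≠ 0 ∧
        (∀ s : ℝ,
          IsImproperAffineSphere (Pi.basisFun ℝ (Fin n)).det
            {x : Fin n → ℝ | lsaCharPoly A (b.equivFun.symm x) = s} ∧
          ∃ c : ℝ, c ≠ 0 ∧
            IsEquiaffineNormal (Pi.basisFun ℝ (Fin n)).det
              {x : Fin n → ℝ | lsaCharPoly A (b.equivFun.symm x) = s}
              (fun _ => c • b.equivFun v)) ∧
        α ≠ 0 ∧
        IsRightPrincipalIdempotent A (α⁻¹ • v) ∧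
        lsaTraceRight A (α⁻¹ • v) = 1) := by
  let e := b.equivFun.symm
  have hconst := expHessDet_lsaCharPoly_eq e (Pi.basisFun ℝ (Fin n)) hv hP (by simpa using hLR)
  refine ⟨_, fun x => hconst x 0 ▸ hessianDet_exp (contDiff_lsaCharPoly e) x, fun hτ => ?_⟩
  have := b.finiteDimensional_of_finite
  have hvτ := lsaTraceForm_apply_of_translation hP
  have hα : α ≠ 0 := fun h => hv (hτ.1 v fun x => by rw [hvτ, h, zero_mul])
  have hr (x : Fin n → ℝ) (t : ℝ) :
      lsaCharPoly A (e (x + t • b.equivFun (α⁻¹ • v))) = lsaCharPoly A (e x) + t := by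
    rw [map_add, map_smul, b.equivFun.symm_apply_apply,
      apply_add_smul_inv_smul_of_translation hα hP]
  have hrτ (x : A) : lsaTraceRight A x = lsaTraceForm A (α⁻¹ • v) x := by
    rw [map_smul, LinearMap.smul_apply, hvτ, smul_eq_mul, inv_mul_cancel_left₀ hα]
  have hr1 : lsaTraceRight A (α⁻¹ • v) = 1 := by
    rw [map_smul, lsaTraceRight_of_translation hP, smul_eq_mul, inv_mul_cancel₀ hα]
  have hκ := (expHessDet_ne_zero_iff (Pi.basisFun ℝ (Fin n))).2
    (nondegenerate_expHess_lsaCharPoly_zero e hτ.2 hrτ hr1)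
  refine ⟨hκ, fun s => ⟨isImproperAffineSphere_levelSet _ (contDiff_lsaCharPoly e) hr hκ
    fun p _ => hconst p 0, ?_⟩, hα, isRightPrincipalIdempotent_of_separatingRight hτ.2 hrτ, hr1⟩
  obtain ⟨c, hc, h, hnormal⟩ := exists_isEquiaffineNormalWith_levelSet (s := s) _
    (contDiff_lsaCharPoly e) hr hκ fun p _ => hconst p 0
  exact ⟨c * α⁻¹, mul_ne_zero hc (inv_ne_zero hα), h, _, by
    simpa only [map_smul, smul_smul] using hnormal⟩
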